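/- Let $X$ be a nonzero finite-dimensional complex Hilbert space. An observable structure on $X$ is a $\dagger$-special commutative Frobenius algebra in $\mathbf{FHilb}$: linear maps $\mu:X\otimes X\to X$, $\eta:\mathbb C\to X$, $\delta:X\to X\otimes X$, $\epsilon:X\to\mathbb C$ such that $(X,\mu,\eta)$ is a commutative monoid, $(X,\delta,\epsilon)$ is a cocommutative comonoid, $\delta=\mu^\dagger$, $\epsilon=\eta^\dagger$, the Frobenius law $(1\otimes\mu)(\delta\otimes 1)=\delta\mu=(\mu\otimes 1)(1\otimes\delta)$ holds, and $\mu\delta=1_X$. Two observable structures $A=(\mu_A,\eta_A,\delta_A,\epsilon_A)$ and $B=(\mu_B,\eta_B,\delta_B,\epsilon_B)$ on $X$ are strongly complementary if they are coherent, i.e. $$(\epsilon_B\eta_A)\cdot\delta_B\eta_A=\eta_A\otimes\eta_A,\qquad (\epsilon_A\eta_B)\cdot\delta_A\eta_B=\eta_B\otimes\eta_B,$$ and satisfy, with $\sigma$ the swap map, the scaled bialgebra equation $$\delta_B\,\mu_A=(\epsilon_B\eta_A)\cdot(\mu_A\otimes\mu_A)(1\otimes\sigma\otimes 1)(\delta_B\otimes\delta_B).$$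 (1) For every strongly complementary pair $(A,B)$ on $X$ there are a finite abelian group $(G,+,0)$, an orthonormal basis $\{|g\rangle\}_{g\in G}$ of $X$, and a complex number $c$ with $|c|=1$ such that, writing $D=|G|$, $$\delta_B|g\rangle=|g\rangle\otimes|g\rangle,\qquad \epsilon_B|g\rangle=1,\qquad \mu_A(|g\rangle\otimes|h\rangle)=c^{-1}\tfrac1{\sqrt D}\,|g+h\rangle,\qquad \eta_A(1)=c\sqrt D\,|0\rangle$$ for all $g,h\in G$. The phase is determined by $\epsilon_B\eta_A=c\sqrt D$; in particular $c=1$ exactly when the scalar $\epsilon_B\eta_A$ is positive. (2) Conversely, for every finite abelian group $G$, every orthonormal basis of $X$ indexed by $G$, and every $c\in\mathbb C$ with $|c|=1$ (in particular $c=1$), there are observable structures $A$ and $B$ on $X$ given by these formulas, and every pair of observable structures given by these formulas is strongly complementary. -/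

import Mathlib

open scoped TensorProduct

noncomputable section

/-- An observable structure on a finite-dimensional Hilbert space `X`, that is, a dagger-special
commutative Frobenius algebra in the dagger symmetric monoidal category of finite-dimensional
complex Hilbert spaces and linear maps. The tensor product carries its Hilbert space structure, the
monoidal unit is `ℂ`, and the dagger is the Hilbert space adjoint. -/
structure ObservableStructure (X : Type*) [NormedAddCommGroup X] [InnerProductSpace ℂ X]
    [FiniteDimensional ℂ X] where
  /-- multiplication -/
  mul : X ⊗[ℂ] X →ₗ[ℂ] X
  /-- unit -/
  unit : ℂ →ₗ[ℂ] X
  /-- comultiplication -/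
  comul : X →ₗ[ℂ] X ⊗[ℂ] X
  /-- counit -/
  counit : X →ₗ[ℂ] ℂ
  /-- the comultiplication is the dagger of the multiplication -/
  comul_eq_adjoint : comul = LinearMap.adjoint mul
  /-- the counit is the dagger of the unit -/
  counit_eq_adjoint : counit = LinearMap.adjoint unit
  /-- associativity -/
  mul_assoc : mul ∘ₗ mul.rTensor X =
    mul ∘ₗ mul.lTensor X ∘ₗ (TensorProduct.assoc ℂ X X X).toLinearMap
  /-- left unit law -/
  unit_mul : mul ∘ₗ unit.rTensor X = (TensorProduct.lid ℂ X).toLinearMap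
  /-- right unit law -/
  mul_unit : mul ∘ₗ unit.lTensor X = (TensorProduct.rid ℂ X).toLinearMap
  /-- commutativity -/
  mul_comm : mul ∘ₗ (TensorProduct.comm ℂ X X).toLinearMap = mul
  /-- coassociativity -/
  comul_coassoc : (TensorProduct.assoc ℂ X X X).toLinearMap ∘ₗ comul.rTensor X ∘ₗ comul =
    comul.lTensor X ∘ₗ comul
  /-- left counit law -/
  counit_comul : counit.rTensor X ∘ₗ comul = (TensorProduct.lid ℂ X).symm.toLinearMap
  /-- right counit law -/
  comul_counit : counit.lTensor X ∘ₗ comul = (TensorProduct.rid ℂ X).symm.toLinearMap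
  /-- cocommutativity -/
  comul_comm : (TensorProduct.comm ℂ X X).toLinearMap ∘ₗ comul = comul
  /-- the Frobenius law `(1 ⊗ μ) ∘ (δ ⊗ 1) = δ ∘ μ` -/
  frobenius_left : mul.lTensor X ∘ₗ (TensorProduct.assoc ℂ X X X).toLinearMap ∘ₗ
    comul.rTensor X = comul ∘ₗ mul
  /-- the Frobenius law `(μ ⊗ 1) ∘ (1 ⊗ δ) = δ ∘ μ` -/
  frobenius_right : mul.rTensor X ∘ₗ (TensorProduct.assoc ℂ X X X).symm.toLinearMap ∘ₗ
    comul.lTensor X = comul ∘ₗ mul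
  /-- specialness `μ ∘ δ = 1` -/
  special : mul ∘ₗ comul = LinearMap.id

namespace ObservableStructure

variable {X : Type*} [NormedAddCommGroup X] [InnerProductSpace ℂ X] [FiniteDimensional ℂ X]

/-- The scalar `ε_B ∘ η_A : ℂ → ℂ`, as a complex number: the counit of `B` applied to the unit
of `A`. -/
def scalar (A B : ObservableStructure X) : ℂ := B.counit (A.unit 1)

/-- `A` and `B` are coherent: each comultiplication copies the unit of the other structure,
up to the scalar formed by that unit and the counit belonging to the comultiplication. -/
structure Coherent (A B : ObservableStructure X) : Prop where
  comul_unit_left :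
    scalar A B • B.comul (A.unit 1) = A.unit 1 ⊗ₜ[ℂ] A.unit 1
  comul_unit_right :
    scalar B A • A.comul (B.unit 1) = B.unit 1 ⊗ₜ[ℂ] B.unit 1

/-- `A` and `B` are strongly complementary: they are coherent and satisfy the scaled bialgebra
equation `δ_B ∘ μ_A = (ε_B ∘ η_A) · (μ_A ⊗ μ_A) ∘ (1 ⊗ σ ⊗ 1) ∘ (δ_B ⊗ δ_B)`. -/
structure StronglyComplementary (A B : ObservableStructure X) : Prop where
  coherent : Coherent A B
  bialgebra : B.comul ∘ₗ A.mul = scalar A B • (TensorProduct.map A.mul A.mul ∘ₗ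
    (TensorProduct.tensorTensorTensorComm ℂ X X X X).toLinearMap ∘ₗ
    TensorProduct.map B.comul B.comul)

/-- The pair `(A, B)` comes from the finite abelian group `G` through the orthonormal basis
`b = (|g⟩)` and the phase `c`: the structure `B` copies and deletes the basis, while `A` multiplies
`|g⟩ ⊗ |h⟩ ↦ c⁻¹ (1/√D) |g + h⟩` and has unit `c √D |0⟩`, where `D = |G|`. -/
structure IsGroupPair {G : Type*} [AddCommGroup G] [Fintype G] (b : OrthonormalBasis G ℂ X)
    (c : ℂ) (A B : ObservableStructure X) : Prop where
  comul_basis : ∀ g, B.comul (b g) = b g ⊗ₜ[ℂ] b g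
  counit_basis : ∀ g, B.counit (b g) = 1
  mul_basis : ∀ g h, A.mul (b g ⊗ₜ[ℂ] b h) =
    (c⁻¹ * (1 / (Real.sqrt (Fintype.card G) : ℂ))) • b (g + h)
  unit_one : A.unit 1 = (c * (Real.sqrt (Fintype.card G) : ℂ)) • b 0

end ObservableStructure

end

/-! By the Frobenius law the adjoint of a left multiplication is again a left multiplication
(`adjoint_mulLeft`). The left multiplications are thus a commuting family closed under adjoints, and
the spectral theorem gives a spanning set of joint eigenvectors. Each nonzero one rescales to a
copyable vector, and specialness makes copyable vectors orthonormal, so every observable structure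
copies an orthonormal basis (`exists_basis_comul`).

For a strongly complementary pair with scalar `s`, take the basis copied by `B`. The bialgebra
equation makes `s` times the `A`-product of two basis vectors copyable, and coherence makes it
nonzero, so it is a basis vector (`StronglyComplementary.exists_add`). This yields a binary
operation on the indices, with associativity and commutativity from `A`, zero from the unit of `A`,
and inverses from the involution of `A` (`exists_add_eq`). Specialness of `A` forces `‖s‖ ^ 2 = D`,
leaving only a phase free.

The converse is checked on basis vectors, with adjoints computed by inner products. -/

noncomputable section

namespace ObservableStructure

open scoped ComplexConjugate

section

variable {X : Type*} [NormedAddCommGroup X] [InnerProductSpace ℂ X]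

/-- Contraction of the first tensor factor with a vector. -/
def contractLeft (x : X) : X ⊗[ℂ] X →ₗ[ℂ] X :=
  (TensorProduct.lid ℂ X).toLinearMap ∘ₗ (innerₛₗ ℂ x).rTensor X

lemma inner_contractLeft (x w : X) (t : X ⊗[ℂ] X) :
    inner ℂ w (contractLeft x t) = inner ℂ (x ⊗ₜ[ℂ] w) t := by
  induction t with
  | zero => simp
  | tmul a b => simp [contractLeft]
  | add a b ha hb => simp only [map_add, inner_add_right, ha, hb]

variable [FiniteDimensional ℂ X]

/-! ### Spectral theory of one observable structure -/

section Algebra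

variable (A : ObservableStructure X)

lemma inner_comul_right (t : X ⊗[ℂ] X) (y : X) :
    inner ℂ t (A.comul y) = inner ℂ (A.mul t) y := by
  rw [A.comul_eq_adjoint, LinearMap.adjoint_inner_right]

lemma inner_unit_left (y : X) : inner ℂ (A.unit 1) y = A.counit y := by
  rw [A.counit_eq_adjoint, ← LinearMap.adjoint_inner_right]
  simp

lemma unit_mul_apply (y : X) : A.mul (A.unit 1 ⊗ₜ y) = y := by
  simpa using LinearMap.congr_fun A.unit_mul (1 ⊗ₜ y)

lemma mul_unit_apply (y : X) : A.mul (y ⊗ₜ A.unit 1) = y := by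
  simpa using LinearMap.congr_fun A.mul_unit (y ⊗ₜ 1)

lemma mul_comm_apply (x y : X) : A.mul (x ⊗ₜ y) = A.mul (y ⊗ₜ x) := by
  simpa using LinearMap.congr_fun A.mul_comm (y ⊗ₜ x)

lemma mul_assoc_apply (x y z : X) :
    A.mul (A.mul (x ⊗ₜ y) ⊗ₜ z) = A.mul (x ⊗ₜ A.mul (y ⊗ₜ z)) := by
  simpa using LinearMap.congr_fun A.mul_assoc (x ⊗ₜ y ⊗ₜ z)

lemma mul_comul_apply (x : X) : A.mul (A.comul x) = x := by
  simpa using LinearMap.congr_fun A.special x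

lemma unit_ne_zero [Nontrivial X] : A.unit 1 ≠ 0 := by
  obtain ⟨x, hx⟩ := exists_ne (0 : X)
  intro h
  apply hx
  rw [← A.unit_mul_apply x, h, TensorProduct.zero_tmul, map_zero]

/-- Left multiplication by a vector. -/
def mulLeft : X →ₗ[ℂ] X →ₗ[ℂ] X := TensorProduct.curry A.mul

@[simp] lemma mulLeft_apply (x y : X) : A.mulLeft x y = A.mul (x ⊗ₜ y) := rfl

lemma commute_mulLeft (x y : X) : Commute (A.mulLeft x) (A.mulLeft y) := by
  ext z
  simp only [Module.End.mul_apply, mulLeft_apply]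
  rw [← mul_assoc_apply, A.mul_comm_apply x y, mul_assoc_apply]

lemma adjoint_mulLeft_apply (x y : X) :
    LinearMap.adjoint (A.mulLeft x) y = contractLeft x (A.comul y) := by
  refine ext_inner_left ℂ fun w => ?_
  rw [LinearMap.adjoint_inner_right, inner_contractLeft, inner_comul_right, mulLeft_apply]

/-- The adjoint of left multiplication is linear over right multiplication. -/
lemma adjoint_mulLeft_mul (x y z : X) :
    LinearMap.adjoint (A.mulLeft x) (A.mul (y ⊗ₜ z)) =
      A.mul (LinearMap.adjoint (A.mulLeft x) y ⊗ₜ z) := by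
  have h : contractLeft x ∘ₗ A.mul.lTensor X ∘ₗ (TensorProduct.assoc ℂ X X X).toLinearMap =
      A.mul ∘ₗ (contractLeft x).rTensor X := by
    ext a b c
    simp [contractLeft, ← TensorProduct.smul_tmul']
  have hF := LinearMap.congr_fun A.frobenius_left (y ⊗ₜ z)
  have hx := LinearMap.congr_fun h (A.comul y ⊗ₜ z)
  simp only [LinearMap.comp_apply, LinearMap.rTensor_tmul] at hF hx
  rw [adjoint_mulLeft_apply, adjoint_mulLeft_apply, ← hF, hx]

/-- The involution of the algebra: left multiplication by `A.inv x` is adjoint to left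
multiplication by `x`. -/
def inv (x : X) : X := LinearMap.adjoint (A.mulLeft x) (A.unit 1)

/-- A map commuting with right multiplications is determined by its value at the unit. -/
lemma adjoint_mulLeft (x : X) : LinearMap.adjoint (A.mulLeft x) = A.mulLeft (A.inv x) := by
  ext z
  conv_lhs => rw [← A.unit_mul_apply z]
  rw [adjoint_mulLeft_mul, inv, mulLeft_apply]

lemma inner_mulLeft (x y z : X) :
    inner ℂ (A.mul (x ⊗ₜ y)) z = inner ℂ y (A.mul (A.inv x ⊗ₜ z)) := by
  rw [← mulLeft_apply, ← mulLeft_apply, ← adjoint_mulLeft, LinearMap.adjoint_inner_right]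

lemma inv_inv_mul (x y : X) : A.mul (A.inv (A.inv x) ⊗ₜ y) = A.mul (x ⊗ₜ y) := by
  rw [← mulLeft_apply, ← mulLeft_apply, ← adjoint_mulLeft, ← adjoint_mulLeft,
    LinearMap.adjoint_adjoint]

/-- The spectral theorem used below needs symmetric operators; every `x` is a complex combination of
two elements, its real and imaginary parts, that act symmetrically. -/
lemma exists_mulLeft_smul_of_symmetric {v : X}
    (hv : ∀ x, (A.mulLeft x).IsSymmetric → ∃ c : ℂ, A.mulLeft x v = c • v) (x : X) :
    ∃ c : ℂ, A.mulLeft x v = c • v := by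
  have h₁ : (A.mulLeft (x + A.inv x)).IsSymmetric := fun y z => by
    simp only [map_add, LinearMap.add_apply, inner_add_left, inner_add_right, mulLeft_apply,
      inner_mulLeft, inv_inv_mul]
    ring
  have h₂ : (A.mulLeft (Complex.I • (x - A.inv x))).IsSymmetric := fun y z => by
    simp only [map_sub, map_smul, LinearMap.sub_apply, LinearMap.smul_apply, inner_sub_left,
      inner_sub_right, inner_smul_left, inner_smul_right, mulLeft_apply, inner_mulLeft,
      inv_inv_mul, Complex.conj_I]
    ring
  obtain ⟨a, ha⟩ := hv _ h₁
  obtain ⟨d, hd⟩ := hv _ h₂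
  refine ⟨2⁻¹ * (a - Complex.I * d), ?_⟩
  have hx : x = (2⁻¹ : ℂ) • ((x + A.inv x) - Complex.I • (Complex.I • (x - A.inv x))) := by
    rw [smul_smul, Complex.I_mul_I]
    module
  rw [hx, map_smul, map_sub, map_smul, LinearMap.smul_apply, LinearMap.sub_apply,
    LinearMap.smul_apply, ha, hd]
  module

/-- The nonzero vectors that are copied by the comultiplication. -/
def copyable : Set X := {v | v ≠ 0 ∧ A.comul v = v ⊗ₜ v}

/-- A joint eigenvector of all left multiplications is copyable up to a scalar. -/
lemma mem_span_copyable_of_eigenvector {v : X} (hv : ∀ x, ∃ c : ℂ, A.mulLeft x v = c • v) :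
    v ∈ Submodule.span ℂ A.copyable := by
  by_cases h0 : v = 0
  · simp [h0]
  choose χ hχ using hv
  -- Taking `b` to be the unit identifies the eigenvalue, up to the counit of `v`, with the pairing
  -- against `v`; hence that pairing is multiplicative up to this factor.
  have key (a b : X) : inner ℂ (A.mul (a ⊗ₜ b)) v = χ (A.inv a) * inner ℂ b v := by
    rw [inner_mulLeft, ← mulLeft_apply, hχ, inner_smul_right]
  have key' (a : X) : inner ℂ a v = χ (A.inv a) * A.counit v := by
    rw [← inner_unit_left, ← key, mul_unit_apply]
  have hk : A.counit v ≠ 0 := fun h => h0 <| by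
    have := key' v
    rwa [h, mul_zero, inner_self_eq_zero] at this
  have hc : A.counit v • A.comul v = v ⊗ₜ v := by
    rw [TensorProduct.ext_iff_inner_left]
    intro a b
    rw [inner_smul_right, inner_comul_right, key, TensorProduct.inner_tmul, key' a]
    ring
  have hmem : (A.counit v)⁻¹ • v ∈ A.copyable := by
    refine ⟨smul_ne_zero (inv_ne_zero hk) h0, ?_⟩
    rw [map_smul, TensorProduct.smul_tmul_smul, ← hc, smul_smul]
    congr 1
    field_simp
  have := Submodule.smul_mem _ (A.counit v) (Submodule.subset_span (R := ℂ) hmem)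
  rwa [smul_smul, mul_inv_cancel₀ hk, one_smul] at this

lemma span_copyable : Submodule.span ℂ A.copyable = ⊤ := by
  have h := LinearMap.IsSymmetric.iSup_iInf_eq_top_of_commute
    (T := fun x : {x : X // (A.mulLeft x).IsSymmetric} => A.mulLeft x)
    (fun x => x.2) (fun x y _ => A.commute_mulLeft x y)
  rw [eq_top_iff, ← h]
  refine iSup_le fun χ v hv => A.mem_span_copyable_of_eigenvector ?_
  refine A.exists_mulLeft_smul_of_symmetric fun x hx => ⟨χ ⟨x, hx⟩, ?_⟩
  exact Module.End.mem_eigenspace_iff.mp ((Submodule.mem_iInf _).mp hv ⟨x, hx⟩)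

/-- Since comultiplication is an isometry by specialness, `⟪u, v⟫ ^ 2 = ⟪u, v⟫`, so each inner
product is 0 or 1; between unit vectors, 1 means equality. -/
lemma orthonormal_copyable : Orthonormal ℂ ((↑) : A.copyable → X) := by
  have key (u v : A.copyable) :
      inner ℂ (u : X) v * inner ℂ (u : X) v = inner ℂ (u : X) (v : X) := by
    rw [← TensorProduct.inner_tmul, ← u.2.2, ← v.2.2, inner_comul_right, mul_comul_apply]
  have h01 (u v : A.copyable) : inner ℂ (u : X) v = 0 ∨ inner ℂ (u : X) v = 1 := by
    rcases eq_or_ne (inner ℂ (u : X) v) 0 with h | h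
    · exact Or.inl h
    · exact Or.inr (mul_right_cancel₀ h ((key u v).trans (one_mul _).symm))
  have hn (u : A.copyable) : ‖(u : X)‖ = 1 := by
    have h := (h01 u u).resolve_left (inner_self_ne_zero.mpr u.2.1)
    rw [norm_eq_sqrt_re_inner (𝕜 := ℂ), h]
    simp
  refine ⟨hn, fun u v huv => (h01 u v).resolve_right fun h => huv ?_⟩
  exact Subtype.ext ((inner_eq_one_iff_of_norm_eq_one (hn u) (hn v)).mp h)

/-- The comultiplication copies an orthonormal basis. -/
lemma exists_basis_comul : ∃ (n : ℕ) (b : OrthonormalBasis (Fin n) ℂ X),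
    ∀ i, A.comul (b i) = b i ⊗ₜ b i := by
  have hfin : Finite A.copyable := A.orthonormal_copyable.linearIndependent.finite
  have := Fintype.ofFinite A.copyable
  let b := OrthonormalBasis.mk A.orthonormal_copyable (by simp [span_copyable])
  refine ⟨_, b.reindex (Fintype.equivFin _), fun i => ?_⟩
  rw [OrthonormalBasis.reindex_apply, OrthonormalBasis.coe_mk]
  exact ((Fintype.equivFin A.copyable).symm i).2.2

end Algebra

/-! ### From a strongly complementary pair to a group -/

section Basis

variable {A B : ObservableStructure X}

lemma counit_basis_of_comul {ι : Type*} [Fintype ι] (b : OrthonormalBasis ι ℂ X)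
    (hb : ∀ i, B.comul (b i) = b i ⊗ₜ b i) (i : ι) : B.counit (b i) = 1 := by
  have h := LinearMap.congr_fun B.counit_comul (b i)
  simp only [LinearMap.comp_apply, hb, LinearMap.rTensor_tmul] at h
  have h' := congrArg (TensorProduct.lid ℂ X) h
  simp only [TensorProduct.lid_tmul, LinearEquiv.coe_coe, LinearEquiv.apply_symm_apply] at h'
  have h'' := congrArg (inner ℂ (b i)) h'
  simpa [inner_smul_right] using h''

/-- A copyable vector is an element of any orthonormal basis of copyable vectors. -/
lemma exists_eq_basis_of_comul {ι : Type*} [Fintype ι] (b : OrthonormalBasis ι ℂ X)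
    (hb : ∀ i, B.comul (b i) = b i ⊗ₜ b i) {u : X} (hu0 : u ≠ 0)
    (hu : B.comul u = u ⊗ₜ u) : ∃ i, u = b i := by
  by_contra! h
  refine hu0 (InnerProductSpace.ext_inner_left_basis b.toBasis fun i => ?_)
  rw [OrthonormalBasis.coe_toBasis, inner_zero_right]
  exact B.orthonormal_copyable.2 (i := ⟨b i, b.orthonormal.ne_zero i, hb i⟩) (j := ⟨u, hu0, hu⟩)
    fun e => h i (congrArg Subtype.val e).symm

lemma scalar_swap : scalar B A = conj (scalar A B) := by
  rw [scalar, scalar, ← inner_unit_left, ← inner_unit_left, inner_conj_symm]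

section Coherent

variable (h : Coherent A B)
include h

lemma Coherent.scalar_ne_zero [Nontrivial X] : scalar A B ≠ 0 := fun h0 => by
  have := h.comul_unit_left
  rw [h0, zero_smul, eq_comm, ← norm_eq_zero, TensorProduct.norm_tmul, mul_self_eq_zero,
    norm_eq_zero] at this
  exact A.unit_ne_zero this

/-- The counit of `B` is multiplicative for `A` up to the scalar. -/
lemma Coherent.scalar_mul_counit_mul (x y : X) :
    scalar A B * B.counit (A.mul (x ⊗ₜ y)) = B.counit x * B.counit y := by
  -- This is the second coherence equation paired with `x ⊗ₜ y`.
  rw [← inner_unit_left, ← inner_unit_left, ← inner_unit_left, ← TensorProduct.inner_tmul,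
    ← h.comul_unit_right, inner_smul_left, scalar_swap (A := A), Complex.conj_conj,
    ← inner_conj_symm, ← inner_conj_symm (A.comul _), inner_comul_right]

end Coherent

section GroupMul

variable {G : Type*} [AddCommGroup G] [Fintype G] (b : OrthonormalBasis G ℂ X)
  {m : X ⊗[ℂ] X →ₗ[ℂ] X} {t : ℂ} (hm : ∀ g h, m (b g ⊗ₜ b h) = t • b (g + h))
include hm

lemma adjoint_groupMul (k : G) :
    LinearMap.adjoint m (b k) = conj t • ∑ g, b g ⊗ₜ[ℂ] b (k - g) := by
  classical
  refine InnerProductSpace.ext_inner_left_basis (b.tensorProduct b).toBasis fun p => ?_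
  rw [OrthonormalBasis.coe_toBasis, OrthonormalBasis.tensorProduct_apply',
    LinearMap.adjoint_inner_right, hm, inner_smul_right (𝕜 := ℂ) (E := X ⊗[ℂ] X), inner_sum,
    Finset.sum_eq_single p.1 (fun i _ hi => by simp [b.inner_eq_ite, hi.symm]) (by simp)]
  simp [inner_smul_left, b.inner_eq_ite, eq_sub_iff_add_eq']

/-- Each of the `D` pairs `(g, k - g)` contributes one copy of `b k`. This computes `‖s‖` from
specialness, and conversely proves specialness of the group algebra. -/
lemma groupMul_adjoint (k : G) :
    m (LinearMap.adjoint m (b k)) = (conj t * t * Fintype.card G) • b k := by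
  rw [adjoint_groupMul b hm, map_smul, map_sum]
  simp only [hm, add_sub_cancel, Finset.sum_const, Finset.card_univ]
  module

end GroupMul

/-- Up to the scalar, the product of `A` of two basis vectors copied by `B` is a basis vector. -/
lemma StronglyComplementary.exists_add (h : StronglyComplementary A B)
    {ι : Type*} [Fintype ι] (b : OrthonormalBasis ι ℂ X)
    (hb : ∀ i, B.comul (b i) = b i ⊗ₜ b i) (i j : ι) :
    ∃ k, scalar A B • A.mul (b i ⊗ₜ b j) = b k := by
  refine exists_eq_basis_of_comul b hb (fun h0 => ?_) ?_
  · have h1 := h.coherent.scalar_mul_counit_mul (b i) (b j)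
    rw [counit_basis_of_comul b hb, counit_basis_of_comul b hb, ← smul_eq_mul, ← map_smul, h0,
      map_zero] at h1
    norm_num at h1
  · have h1 := LinearMap.congr_fun h.bialgebra (b i ⊗ₜ b j)
    simp only [LinearMap.comp_apply, LinearMap.smul_apply, TensorProduct.map_tmul, hb,
      LinearEquiv.coe_coe, TensorProduct.tensorTensorTensorComm_tmul] at h1
    rw [map_smul, h1, TensorProduct.smul_tmul_smul, smul_smul]

/-- Left multiplication by a basis vector copied by `B` is surjective on basis vectors. -/
lemma exists_add_eq {ι : Type*} [Fintype ι] (b : OrthonormalBasis ι ℂ X) {s : ℂ}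
    {f : ι → ι → ι} (hf : ∀ i j, s • A.mul (b i ⊗ₜ b j) = b (f i j)) (i k : ι) :
    ∃ j, f i j = k := by
  by_contra! hne
  have hs : s ≠ 0 := fun h0 => b.orthonormal.ne_zero (f i k) (by rw [← hf, h0, zero_smul])
  -- If `k` is missed, `b k` is orthogonal to the range of multiplication by `b i`, hence killed by
  -- its adjoint. By commutativity the operator is normal, so it kills `b k` too, although its value
  -- there is a nonzero multiple of a basis vector.
  have h0 : A.mul (A.inv (b i) ⊗ₜ b k) = 0 := by
    refine InnerProductSpace.ext_inner_left_basis b.toBasis fun j => ?_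
    rw [OrthonormalBasis.coe_toBasis, ← inner_mulLeft, inner_zero_right]
    have : inner ℂ (b (f i j)) (b k) = 0 := b.orthonormal.2 (hne j)
    rw [← hf, inner_smul_left] at this
    exact (mul_eq_zero.mp this).resolve_left (by simpa using hs)
  have h1 : A.mul (b i ⊗ₜ b k) = 0 := by
    rw [← inner_self_eq_zero (𝕜 := ℂ), inner_mulLeft, ← mul_assoc_apply,
      A.mul_comm_apply (A.inv _), mul_assoc_apply, h0, TensorProduct.tmul_zero, map_zero,
      inner_zero_right]
  exact b.orthonormal.ne_zero (f i k) (by rw [← hf, h1, smul_zero])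

/-- The group structure on a basis of vectors that are copied by `B`. -/
lemma StronglyComplementary.exists_addCommGroup [Nontrivial X] (h : StronglyComplementary A B)
    {ι : Type*} [Fintype ι] (b : OrthonormalBasis ι ℂ X)
    (hb : ∀ i, B.comul (b i) = b i ⊗ₜ b i) :
    ∃ (_ : AddCommGroup ι) (c : ℂ),
      ‖c‖ = 1 ∧ A.scalar B = c * (Real.sqrt (Fintype.card ι) : ℂ) ∧ A.IsGroupPair b c B := by
  have hs := h.coherent.scalar_ne_zero
  set s := scalar A B with hs_def
  choose f hf using h.exists_add b hb
  -- The first coherence equation says exactly that the unit of `A`, divided by `s`, is copyable.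
  obtain ⟨z, hz⟩ : ∃ z, s⁻¹ • A.unit 1 = b z := by
    refine exists_eq_basis_of_comul b hb (smul_ne_zero (inv_ne_zero hs) A.unit_ne_zero) ?_
    rw [map_smul, TensorProduct.smul_tmul_smul, ← h.coherent.comul_unit_left, smul_smul,
      ← hs_def, _root_.mul_assoc, inv_mul_cancel₀ hs, mul_one]
  have hunit : A.unit 1 = s • b z := by rw [← hz, smul_smul, mul_inv_cancel₀ hs, one_smul]
  have hmul (i j : ι) : A.mul (b i ⊗ₜ b j) = s⁻¹ • b (f i j) := by
    rw [← hf, smul_smul, inv_mul_cancel₀ hs, one_smul]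
  have hinj : Function.Injective b := b.orthonormal.linearIndependent.injective
  have hcomm (i j : ι) : f i j = f j i := hinj (by rw [← hf, ← hf, A.mul_comm_apply])
  have hzero (i : ι) : f z i = i := hinj <| by
    rw [← hf, ← map_smul, TensorProduct.smul_tmul', ← hunit, unit_mul_apply]
  have hassoc (i j k : ι) : f (f i j) k = f i (f j k) := hinj <| by
    rw [← hf, ← hf, ← hf, ← hf, ← TensorProduct.smul_tmul', TensorProduct.tmul_smul, map_smul,
      map_smul, mul_assoc_apply]
  choose neg hneg using fun i => exists_add_eq b hf i z
  let _ : Add ι := ⟨f⟩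
  let _ : Zero ι := ⟨z⟩
  let _ : Neg ι := ⟨neg⟩
  let _ : AddCommGroup ι :=
    { AddGroup.ofLeftAxioms hassoc hzero fun i => (hcomm _ _).trans (hneg i) with
      add_comm := hcomm }
  have hunit' : A.unit 1 = s • b 0 := hunit
  have hmul' (i j : ι) : A.mul (b i ⊗ₜ b j) = s⁻¹ • b (i + j) := hmul i j
  have hcard : ‖s‖ ^ 2 = Fintype.card ι := by
    have h1 := groupMul_adjoint b hmul' 0
    rw [← A.comul_eq_adjoint, mul_comul_apply] at h1
    have h2 := congrArg (inner ℂ (b 0)) h1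
    rw [inner_smul_right, b.inner_eq_one, mul_one, ← Complex.normSq_eq_conj_mul_self, map_inv₀,
      Complex.normSq_eq_norm_sq] at h2
    have h3 : (1 : ℝ) = (‖s‖ ^ 2)⁻¹ * Fintype.card ι := by exact_mod_cast h2
    have h4 : ‖s‖ ^ 2 ≠ 0 := pow_ne_zero 2 (norm_ne_zero_iff.mpr hs)
    field_simp at h3
    exact h3
  have hsqrt : Real.sqrt (Fintype.card ι) = ‖s‖ := by
    rw [← hcard, Real.sqrt_sq (norm_nonneg _)]
  have hn : (‖s‖ : ℂ) ≠ 0 := by exact_mod_cast norm_ne_zero_iff.mpr hs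
  refine ⟨inferInstance, s / ‖s‖, ?_, ?_, hb, counit_basis_of_comul b hb, fun g k => ?_, ?_⟩
  · rw [norm_div, Complex.norm_real, norm_norm, div_self (norm_ne_zero_iff.mpr hs)]
  · rw [hsqrt, div_mul_cancel₀ _ hn]
  · rw [hmul', hsqrt]
    congr 1
    field_simp
  · rw [hunit', hsqrt, div_mul_cancel₀ _ hn]

end Basis

end

section

variable {X : Type*} [NormedAddCommGroup X] [InnerProductSpace ℂ X]

/-! ### Observable structures from a basis and from a group -/

section Construction

lemma ext_tensor_basis {ι Y : Type*} [Fintype ι] [AddCommMonoid Y] [Module ℂ Y]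
    (b : OrthonormalBasis ι ℂ X) {f g : X ⊗[ℂ] X →ₗ[ℂ] Y}
    (h : ∀ i j, f (b i ⊗ₜ b j) = g (b i ⊗ₜ b j)) : f = g :=
  TensorProduct.ext <| b.toBasis.ext fun i => b.toBasis.ext fun j => by simpa using h i j

lemma ext_tensor_basis_threefold {ι Y : Type*} [Fintype ι] [AddCommMonoid Y] [Module ℂ Y]
    (b : OrthonormalBasis ι ℂ X) {f g : (X ⊗[ℂ] X) ⊗[ℂ] X →ₗ[ℂ] Y}
    (h : ∀ i j k, f (b i ⊗ₜ b j ⊗ₜ b k) = g (b i ⊗ₜ b j ⊗ₜ b k)) : f = g :=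
  TensorProduct.ext <| ext_tensor_basis b fun i j => b.toBasis.ext fun k => by
    simpa using h i j k

lemma exists_tensor_lift {ι : Type*} [Fintype ι] (b : OrthonormalBasis ι ℂ X) (F : ι → ι → X) :
    ∃ m : X ⊗[ℂ] X →ₗ[ℂ] X, ∀ i j, m (b i ⊗ₜ b j) = F i j := by
  refine ⟨TensorProduct.lift (b.toBasis.constr ℂ fun i => b.toBasis.constr ℂ (F i)), ?_⟩
  intro i j
  rw [TensorProduct.lift.tmul, ← b.coe_toBasis, Module.Basis.constr_basis,
    Module.Basis.constr_basis]

variable [FiniteDimensional ℂ X]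

lemma adjoint_lid : LinearMap.adjoint (𝕜 := ℂ) (E := ℂ ⊗[ℂ] X) (F := X)
    (TensorProduct.lid ℂ X).toLinearMap =
    (TensorProduct.lid ℂ X).symm.toLinearMap :=
  (TensorProduct.lidIsometry ℂ X).adjoint_toLinearMap_eq_symm

lemma adjoint_rid : LinearMap.adjoint (𝕜 := ℂ) (E := X ⊗[ℂ] ℂ) (F := X)
    (TensorProduct.rid ℂ X).toLinearMap =
    (TensorProduct.rid ℂ X).symm.toLinearMap :=
  (TensorProduct.ridIsometry ℂ X).adjoint_toLinearMap_eq_symm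

lemma adjoint_comm : LinearMap.adjoint (𝕜 := ℂ) (E := X ⊗[ℂ] X) (F := X ⊗[ℂ] X)
    (TensorProduct.comm ℂ X X).toLinearMap =
    (TensorProduct.comm ℂ X X).toLinearMap :=
  (TensorProduct.commIsometry ℂ X X).adjoint_toLinearMap_eq_symm

section OfMul

variable {m : X ⊗[ℂ] X →ₗ[ℂ] X} {u : ℂ →ₗ[ℂ] X}

lemma adjoint_left_unit (h : m ∘ₗ u.rTensor X = (TensorProduct.lid ℂ X).toLinearMap) :
    (LinearMap.adjoint u).rTensor X ∘ₗ LinearMap.adjoint m =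
      (TensorProduct.lid ℂ X).symm.toLinearMap := by
  rw [← adjoint_lid, ← h, LinearMap.adjoint_comp, LinearMap.adjoint_rTensor]

lemma adjoint_right_unit (h : m ∘ₗ u.lTensor X = (TensorProduct.rid ℂ X).toLinearMap) :
    (LinearMap.adjoint u).lTensor X ∘ₗ LinearMap.adjoint m =
      (TensorProduct.rid ℂ X).symm.toLinearMap := by
  rw [← adjoint_rid, ← h, LinearMap.adjoint_comp, LinearMap.adjoint_lTensor]

lemma adjoint_cocomm (h : m ∘ₗ (TensorProduct.comm ℂ X X).toLinearMap = m) :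
    (TensorProduct.comm ℂ X X).toLinearMap ∘ₗ LinearMap.adjoint m = LinearMap.adjoint m := by
  conv_rhs => rw [← h, LinearMap.adjoint_comp, adjoint_comm]

variable (m u) in
/-- An observable structure from a multiplication and a unit: the counit laws and cocommutativity
are the adjoints of the unit laws and commutativity. -/
def ofMul (mul_assoc : m ∘ₗ m.rTensor X =
      m ∘ₗ m.lTensor X ∘ₗ (TensorProduct.assoc ℂ X X X).toLinearMap)
    (unit_mul : m ∘ₗ u.rTensor X = (TensorProduct.lid ℂ X).toLinearMap)
    (mul_unit : m ∘ₗ u.lTensor X = (TensorProduct.rid ℂ X).toLinearMap)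
    (mul_comm : m ∘ₗ (TensorProduct.comm ℂ X X).toLinearMap = m)
    (frobenius : m.lTensor X ∘ₗ (TensorProduct.assoc ℂ X X X).toLinearMap ∘ₗ
      (LinearMap.adjoint m).rTensor X = LinearMap.adjoint m ∘ₗ m)
    (frobenius' : m.rTensor X ∘ₗ (TensorProduct.assoc ℂ X X X).symm.toLinearMap ∘ₗ
      (LinearMap.adjoint m).lTensor X = LinearMap.adjoint m ∘ₗ m)
    (coassoc : (TensorProduct.assoc ℂ X X X).toLinearMap ∘ₗ (LinearMap.adjoint m).rTensor X ∘ₗ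
      LinearMap.adjoint m = (LinearMap.adjoint m).lTensor X ∘ₗ LinearMap.adjoint m)
    (special : m ∘ₗ LinearMap.adjoint m = LinearMap.id) : ObservableStructure X where
  mul := m
  unit := u
  comul := LinearMap.adjoint m
  counit := LinearMap.adjoint u
  comul_eq_adjoint := rfl
  counit_eq_adjoint := rfl
  mul_assoc := mul_assoc
  unit_mul := unit_mul
  mul_unit := mul_unit
  mul_comm := mul_comm
  comul_coassoc := coassoc
  counit_comul := adjoint_left_unit unit_mul
  comul_counit := adjoint_right_unit mul_unit
  comul_comm := adjoint_cocomm mul_comm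
  frobenius_left := frobenius
  frobenius_right := frobenius'
  special := special

end OfMul

lemma adjoint_copyMul {ι : Type*} [Fintype ι] [DecidableEq ι] (b : OrthonormalBasis ι ℂ X)
    {m : X ⊗[ℂ] X →ₗ[ℂ] X} (hm : ∀ i j, m (b i ⊗ₜ b j) = if i = j then b i else 0) (k : ι) :
    LinearMap.adjoint m (b k) = b k ⊗ₜ[ℂ] b k := by
  refine InnerProductSpace.ext_inner_left_basis (b.tensorProduct b).toBasis fun p => ?_
  rw [OrthonormalBasis.coe_toBasis, OrthonormalBasis.tensorProduct_apply',
    LinearMap.adjoint_inner_right, hm, TensorProduct.inner_tmul]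
  simp only [b.inner_eq_ite]
  split_ifs <;> simp_all [b.inner_eq_ite]

/-- Every orthonormal basis is copied by an observable structure. -/
lemma exists_comul_basis {ι : Type*} [Fintype ι] (b : OrthonormalBasis ι ℂ X) :
    ∃ B : ObservableStructure X, ∀ i, B.comul (b i) = b i ⊗ₜ b i := by
  classical
  obtain ⟨m, hm⟩ := exists_tensor_lift b fun i j => if i = j then b i else 0
  have hd := adjoint_copyMul b hm
  let u : ℂ →ₗ[ℂ] X := LinearMap.toSpanSingleton ℂ X (∑ i, b i)
  refine ⟨ofMul m u (ext_tensor_basis_threefold b fun i j k => ?_) ?_ ?_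
    (ext_tensor_basis b fun i j => ?_) (ext_tensor_basis b fun i j => ?_)
    (ext_tensor_basis b fun i j => ?_) (b.toBasis.ext fun i => ?_) (b.toBasis.ext fun i => ?_), hd⟩
  · simp only [LinearMap.comp_apply, LinearMap.rTensor_tmul, LinearMap.lTensor_tmul,
      LinearEquiv.coe_coe, TensorProduct.assoc_tmul, hm]
    split_ifs <;> simp_all
  · refine TensorProduct.ext (LinearMap.ext_ring (b.toBasis.ext fun i => ?_))
    simp [u, TensorProduct.sum_tmul, hm]
  · refine TensorProduct.ext (b.toBasis.ext fun i => LinearMap.ext_ring ?_)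
    simp [u, TensorProduct.tmul_sum, hm]
  · simp only [LinearMap.comp_apply, LinearEquiv.coe_coe, TensorProduct.comm_tmul, hm]
    split_ifs <;> simp_all
  · simp only [LinearMap.comp_apply, LinearMap.rTensor_tmul, LinearEquiv.coe_coe, hd, hm,
      TensorProduct.assoc_tmul, LinearMap.lTensor_tmul]
    split_ifs <;> simp_all
  · simp only [LinearMap.comp_apply, LinearMap.lTensor_tmul, LinearEquiv.coe_coe, hd, hm,
      TensorProduct.assoc_symm_tmul, LinearMap.rTensor_tmul]
    split_ifs <;> simp_all
  · simp [hd]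
  · simp [hd, hm]

/-- The group algebra of a finite abelian group, scaled, is an observable structure. -/
lemma exists_mul_basis {G : Type*} [AddCommGroup G] [Fintype G] (b : OrthonormalBasis G ℂ X)
    {s : ℂ} (hs : conj s * s = Fintype.card G) :
    ∃ A : ObservableStructure X, (∀ g h, A.mul (b g ⊗ₜ b h) = s⁻¹ • b (g + h)) ∧
      A.unit 1 = s • b 0 := by
  have hs0 : s ≠ 0 := by
    rintro rfl
    simp [eq_comm] at hs
  obtain ⟨m, hm⟩ := exists_tensor_lift b fun i j => s⁻¹ • b (i + j)
  have hd := adjoint_groupMul b hm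
  let u : ℂ →ₗ[ℂ] X := LinearMap.toSpanSingleton ℂ X (s • b 0)
  refine ⟨ofMul m u (ext_tensor_basis_threefold b fun i j k => ?_) ?_ ?_
    (ext_tensor_basis b fun i j => ?_) (ext_tensor_basis b fun i j => ?_)
    (ext_tensor_basis b fun i j => ?_) (b.toBasis.ext fun i => ?_) (b.toBasis.ext fun i => ?_), hm,
    LinearMap.toSpanSingleton_apply_one _ _ _⟩
  · simp [hm, ← TensorProduct.smul_tmul', add_assoc]
  · refine TensorProduct.ext (LinearMap.ext_ring (b.toBasis.ext fun i => ?_))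
    simp [u, ← TensorProduct.smul_tmul', hm, hs0]
  · refine TensorProduct.ext (b.toBasis.ext fun i => LinearMap.ext_ring ?_)
    simp [u, hm, hs0]
  · simp [hm, add_comm]
  · simp [hm, hd, ← TensorProduct.smul_tmul', TensorProduct.sum_tmul, Finset.smul_sum,
      smul_smul, _root_.mul_comm, add_sub_right_comm]
  · simp only [LinearMap.comp_apply, LinearMap.lTensor_tmul, LinearEquiv.coe_coe, hd, hm, map_smul,
      map_sum, TensorProduct.tmul_smul, TensorProduct.tmul_sum, TensorProduct.assoc_symm_tmul,
      LinearMap.rTensor_tmul, ← TensorProduct.smul_tmul', ← Finset.smul_sum]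
    rw [smul_comm]
    congr 2
    refine Fintype.sum_equiv (Equiv.addLeft i) _ _ fun g => ?_
    simp
  · simp only [LinearMap.comp_apply, LinearMap.lTensor_tmul, LinearEquiv.coe_coe, hd, map_smul,
      map_sum, TensorProduct.tmul_smul, TensorProduct.tmul_sum, TensorProduct.assoc_tmul,
      LinearMap.rTensor_tmul, ← TensorProduct.smul_tmul', TensorProduct.sum_tmul,
      ← Finset.smul_sum, OrthonormalBasis.coe_toBasis]
    congr 2
    rw [Finset.sum_comm]
    -- Both sides sum over triples of indices with total `i`; the shift matches the two
    -- parametrizations.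
    refine Finset.sum_congr rfl fun h _ => Fintype.sum_equiv (Equiv.subRight h) _ _ fun g => ?_
    simp
  · have h1 := groupMul_adjoint b hm i
    rw [← hs, map_inv₀] at h1
    simp only [LinearMap.comp_apply, OrthonormalBasis.coe_toBasis, h1, LinearMap.id_apply]
    have : conj s ≠ 0 := by simpa using hs0
    rw [show (conj s)⁻¹ * s⁻¹ * (conj s * s) = 1 by field_simp, one_smul]

end Construction

/-! ### Group pairs are strongly complementary -/

section Converse

variable [FiniteDimensional ℂ X] {G : Type*} [AddCommGroup G] [Fintype G]
  {b : OrthonormalBasis G ℂ X} {c : ℂ}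

lemma exists_isGroupPair (b : OrthonormalBasis G ℂ X) (hc : ‖c‖ = 1) :
    ∃ A B : ObservableStructure X, A.IsGroupPair b c B := by
  obtain ⟨B, hB⟩ := exists_comul_basis b
  have hs : conj (c * (Real.sqrt (Fintype.card G) : ℂ)) * (c * (Real.sqrt (Fintype.card G) : ℂ)) =
      Fintype.card G := by
    rw [← Complex.normSq_eq_conj_mul_self, Complex.normSq_eq_norm_sq, norm_mul, hc, one_mul,
      Complex.norm_real, Real.norm_eq_abs, sq_abs, Real.sq_sqrt (Nat.cast_nonneg _)]
    simp
  obtain ⟨A, hA, hA'⟩ := exists_mul_basis b hs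
  refine ⟨A, B, hB, counit_basis_of_comul b hB, fun g h => ?_, hA'⟩
  rw [hA, mul_inv, one_div]

lemma IsGroupPair.stronglyComplementary {A B : ObservableStructure X} (h : A.IsGroupPair b c B)
    (hc : ‖c‖ = 1) : A.StronglyComplementary B := by
  have hD : (Real.sqrt (Fintype.card G) : ℂ) ≠ 0 := by simp
  have hc0 : c ≠ 0 := norm_ne_zero_iff.mp (by rw [hc]; exact one_ne_zero)
  set s : ℂ := c * (Real.sqrt (Fintype.card G) : ℂ) with hs
  have hs0 : s ≠ 0 := mul_ne_zero hc0 hD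
  have hscalar : scalar A B = s := by
    rw [scalar, h.unit_one, map_smul, h.counit_basis, smul_eq_mul, mul_one]
  have hmul (i j : G) : A.mul (b i ⊗ₜ b j) = s⁻¹ • b (i + j) := by
    rw [h.mul_basis, hs, mul_inv, one_div]
  refine ⟨⟨?_, ?_⟩, ext_tensor_basis b fun i j => ?_⟩
  · rw [hscalar, h.unit_one, map_smul, h.comul_basis, ← hs, TensorProduct.smul_tmul_smul,
      smul_smul]
  · rw [scalar_swap, hscalar]
    -- The unit of `B` has all coordinates 1, so the second coherence equation can be compared
    -- coordinatewise.
    have hunit (i : G) : inner ℂ (b i) (B.unit 1) = 1 := by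
      rw [← inner_conj_symm, inner_unit_left, h.counit_basis, map_one]
    refine InnerProductSpace.ext_inner_left_basis (b.tensorProduct b).toBasis fun p => ?_
    rw [OrthonormalBasis.coe_toBasis, OrthonormalBasis.tensorProduct_apply',
      inner_smul_right (𝕜 := ℂ) (E := X ⊗[ℂ] X), inner_comul_right, hmul, inner_smul_left,
      TensorProduct.inner_tmul, hunit, hunit, hunit, map_inv₀, mul_one, mul_one,
      mul_inv_cancel₀ (by simpa using hs0)]
  · simp only [LinearMap.comp_apply, LinearMap.smul_apply, TensorProduct.map_tmul, h.comul_basis,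
      hmul, LinearEquiv.coe_coe, TensorProduct.tensorTensorTensorComm_tmul, hscalar, map_smul,
      TensorProduct.smul_tmul_smul, smul_smul]
    rw [← _root_.mul_assoc, mul_inv_cancel₀ hs0, one_mul]

end Converse

end

end ObservableStructure

end

theorem mainTheorem1 {X : Type*} [NormedAddCommGroup X] [InnerProductSpace ℂ X]
    [FiniteDimensional ℂ X] [Nontrivial X] :
    -- every strongly complementary pair is a group pair, up to a phase fixed by its scalar
    (∀ A B : ObservableStructure X, A.StronglyComplementary B →
      ∃ (G : Type) (_ : AddCommGroup G) (_ : Fintype G) (b : OrthonormalBasis G ℂ X) (c : ℂ),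
        ‖c‖ = 1 ∧ A.scalar B = c * (Real.sqrt (Fintype.card G) : ℂ) ∧ A.IsGroupPair b c B) ∧
    -- conversely, the formulas define observable structures, which are strongly complementary
    (∀ (G : Type*) [AddCommGroup G] [Fintype G] (b : OrthonormalBasis G ℂ X) (c : ℂ), ‖c‖ = 1 →
      (∃ A B : ObservableStructure X, A.IsGroupPair b c B) ∧
      ∀ A B : ObservableStructure X, A.IsGroupPair b c B → A.StronglyComplementary B) := by
  refine ⟨fun A B h => ?_, fun G _ _ b c hc =>
    ⟨ObservableStructure.exists_isGroupPair b hc, fun A B h => h.stronglyComplementary hc⟩⟩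
  -- Indexing the basis by `Fin n` puts the group in `Type`, whatever the universe of `X`.
  obtain ⟨n, b, hb⟩ := B.exists_basis_comul
  obtain ⟨hG, c, h'⟩ := h.exists_addCommGroup b hb
  exact ⟨Fin n, hG, inferInstance, b, c, h'⟩
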